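/- Let $p>1$, $\theta\in(0,1)$, let $D\in C^1(0,1)$ with $D>0$ in $(0,1)$, let $H\in C^1[0,1]$ with $H(0)=0$, $H>0$ in $(0,1]$ and $h=H'$, and let $g\in C[0,1]$ with $g=0$ in $[0,\theta]$, $g>0$ in $(\theta,1)$ and $g(1)=0$. Let $c>0$ and let $u:\mathbb R\to[0,1]$ be a solution of $$\bigl(D(u)|u'|^{p-2}u'\bigr)'+(c+h(u))u'+g(u)=0,\qquad u(-\infty)=1,\quad u(+\infty)=0,$$ in the following sense: $u$ is continuous; $u$ is $C^1$ on the open set $I_u=\{\xi: 0<u(\xi)<1\}$ and the equation holds at every point of $I_u$; the flux $\xi\mapsto D(u(\xi))|u'(\xi)|^{p-2}u'(\xi)$ (understood as $0$ outside $I_u$) is continuous on $\mathbb R$ and tends to $0$ as $u(\xi)\to0$ and as $u(\xi)\to1$; $u(\xi)\to1$ as $\xi\to-\infty$ and $u(\xi)\to0$ as $\xi\to+\infty$. Put $\xi_1=\inf I_u\in[-\infty,+\infty)$. Assume that $\lim_{v\to1-}D(v)/(1-v)^{\beta}$ and $\lim_{v\to1-}g(v)/(1-v)^{\gamma}$ exist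 and lie in $(0,+\infty)$, where $\beta\in\mathbb R$ and $\gamma>0$ satisfy $$-1<\gamma+\frac{\beta}{p-1}\le\frac1{p-1}.$$ If $\frac{\gamma-\beta+1}{p}<1$, then $\xi_1>-\infty$ and $u\equiv1$ on $(-\infty,\xi_1]$, so the profile reaches $1$ at a finite point. If $\frac{\gamma-\beta+1}{p}\ge1$, then $\xi_1=-\infty$ and $u<1$ on all of $\mathbb R$. -/

import Mathlib

open Set Filter Topology

noncomputable section

/-- `φ₁ ∼ φ₂` along the filter `l`: the quotient `φ₁ / φ₂` has a limit in `(0, +∞)`. -/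
def SimilarAlong (l : Filter ℝ) (φ₁ φ₂ : ℝ → ℝ) : Prop :=
  ∃ L : ℝ, 0 < L ∧ Tendsto (fun s => φ₁ s / φ₂ s) l (𝓝 L)

/-- The convective velocity `h = H'` on `[0, 1]` (one-sided derivatives at the endpoints). -/
def convVelocity (H : ℝ → ℝ) (v : ℝ) : ℝ := derivWithin H (Icc 0 1) v

/-- The set `I_u` of the points at which the profile lies strictly between the equilibria. -/
def transitionSet (u : ℝ → ℝ) : Set ℝ := {ξ | 0 < u ξ ∧ u ξ < 1}

/-- The flux `D(u) |u'|^(p-2) u'`. If `u` has values in `[0, 1]`, a point outside `I_u` is a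
global extremum of `u`, so `deriv u` vanishes there and the flux is `0`, whatever the values of
`D` at `0` and `1` are. -/
def waveFlux (p : ℝ) (D u : ℝ → ℝ) (ξ : ℝ) : ℝ :=
  D (u ξ) * |deriv u ξ| ^ (p - 2) * deriv u ξ

/-- `u` is a solution of
`(D(u) |u'|^(p-2) u')' + (c + h(u)) u' + g(u) = 0`, `u(-∞) = 1`, `u(+∞) = 0`. -/
structure IsWaveProfile (p c : ℝ) (D H g u : ℝ → ℝ) : Prop where
  continuous : Continuous u
  mem_Icc : ∀ ξ, u ξ ∈ Icc (0 : ℝ) 1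
  contDiffOn : ContDiffOn ℝ 1 u (transitionSet u)
  flux_differentiableAt : ∀ ξ ∈ transitionSet u, DifferentiableAt ℝ (waveFlux p D u) ξ
  equation : ∀ ξ ∈ transitionSet u,
    deriv (waveFlux p D u) ξ + (c + convVelocity H (u ξ)) * deriv u ξ + g (u ξ) = 0
  flux_continuous : Continuous (waveFlux p D u)
  /-- the flux tends to `0` as `u(ξ) → 0` -/
  flux_zero : Tendsto (waveFlux p D u) (comap u (𝓝 0)) (𝓝 0)
  /-- the flux tends to `0` as `u(ξ) → 1` -/
  flux_one : Tendsto (waveFlux p D u) (comap u (𝓝 1)) (𝓝 0)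
  tendsto_atBot : Tendsto u atBot (𝓝 1)
  tendsto_atTop : Tendsto u atTop (𝓝 0)

/-- `ξ₁ ∈ [-∞, +∞]`, the left endpoint of `I_u = (ξ₁, ξ₂)`. -/
def leftEndpoint (u : ℝ → ℝ) : EReal :=
  sInf ((fun ξ : ℝ => (ξ : EReal)) '' transitionSet u)

end

/-! Near `1` put `w = 1 - u` and `y = -waveFlux`, so that `y = D(u) w'^(p-1)` and `y' = g(u) - (c +
h(u)) w'` wherever `w' > 0`. Balancing powers suggests `w' ≍ w^δ` with `δ = (γ-β+1)/p`, that is `y ≍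
w^κ` with `κ = β + δ(p-1)`. The hypotheses on `γ + β/(p-1)` amount to `0 < κ ≤ 1`, and `κ ≤ 1` keeps
the convection term from dominating. Barriers `K w^κ` with `K` large or small make this rigorous
(`exists_w'_le`, `exists_le_w'`). Integrating `w' ≍ w^δ`, the tail vanishes at a finite point if and
only if `δ < 1`. The sign `w' > 0` comes from `IsWaveProfile.deriv_neg`: above `θ` the reaction is
positive, which forbids interior minima. -/

/-- If `E x > 0`, the maximum of `E` on `[t, x]` can only sit at `t`, since elsewhere `E' < 0` makes
larger values appear to the left. Hence `E t ≥ E x` as `t` runs along `l`, against the limit `0`.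
The filter `l` covers both a tail at `-∞` and one starting at a finite point. -/
theorem nonpos_of_deriv_neg_of_tendsto {S : Set ℝ} (hS : S.OrdConnected) {l : Filter ℝ} [l.NeBot]
    (hl : ∀ x ∈ S, ∀ᶠ t in l, t ∈ S ∧ t ≤ x) {E E' : ℝ → ℝ}
    (hE : ∀ x ∈ S, HasDerivAt E (E' x) x) (hneg : ∀ x ∈ S, 0 ≤ E x → E' x < 0)
    (hlim : Tendsto E l (𝓝 0)) : ∀ x ∈ S, E x ≤ 0 := by
  intro x hx
  by_contra! hpos
  have key : ∀ t ∈ S, t ≤ x → E x ≤ E t := by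
    intro t ht htx
    have hsub : Icc t x ⊆ S := hS.out ht hx
    obtain ⟨m, hm, hmax⟩ := isCompact_Icc.exists_isMaxOn (nonempty_Icc.2 htx)
      (fun s hs => (hE s (hsub hs)).continuousAt.continuousWithinAt : ContinuousOn E (Icc t x))
    have hxm : E x ≤ E m := hmax (right_mem_Icc.2 htx)
    rcases eq_or_lt_of_le hm.1 with h | h
    · rwa [h]
    · exfalso
      have hd := hE m (hsub hm)
      have h1 := (hasDerivAt_iff_tendsto_slope_left_right.1 hd).1
      have h2 := h1.eventually (gt_mem_nhds (hneg m (hsub hm) (hpos.le.trans hxm)))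
      obtain ⟨s, hs, hs1⟩ := (h2.and (Ioo_mem_nhdsLT h)).exists
      have hle : E s ≤ E m := hmax ⟨hs1.1.le, hs1.2.le.trans hm.2⟩
      rw [slope_def_field, div_neg_iff] at hs
      rcases hs with hs | hs <;> linarith [hs.1, hs.2, hs1.2]
  have := ge_of_tendsto hlim ((hl x hx).mono fun t ht => key t ht.1 ht.2)
  linarith

/-! ### Two-sided power bounds for `w'` -/

/-- Differential relations between `w = 1 - u`, its derivative `w'` and `y`, minus the flux, near the
equilibrium `1`; `κ` and `δ` are the exponents of `y` and `w'` in terms of `w`. -/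
structure PowerTail (p β γ κ δ M C₁ C₂ : ℝ) (S : Set ℝ) (l : Filter ℝ) (w w' y G m d : ℝ → ℝ) :
    Prop where
  one_lt : 1 < p
  pos_C₁ : 0 < C₁
  pos_C₂ : 0 < C₂
  nonneg_M : 0 ≤ M
  pos_κ : 0 < κ
  κ_le_one : κ ≤ 1
  γ_eq : γ = κ - 1 + δ
  κ_eq : κ = β + δ * (p - 1)
  ordConnected : S.OrdConnected
  eventually_mem : ∀ x ∈ S, ∀ᶠ t in l, t ∈ S ∧ t ≤ x
  w_pos : ∀ x ∈ S, 0 < w x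
  w_le_one : ∀ x ∈ S, w x ≤ 1
  w'_pos : ∀ x ∈ S, 0 < w' x
  hasDerivAt_w : ∀ x ∈ S, HasDerivAt w (w' x) x
  hasDerivAt_y : ∀ x ∈ S, HasDerivAt y (G x - m x * w' x) x
  abs_m_le : ∀ x ∈ S, |m x| ≤ M
  y_eq : ∀ x ∈ S, y x = d x * w' x ^ (p - 1)
  le_G : ∀ x ∈ S, C₁ * w x ^ γ ≤ G x
  G_le : ∀ x ∈ S, G x ≤ C₂ * w x ^ γ
  le_d : ∀ x ∈ S, C₁ * w x ^ β ≤ d x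
  d_le : ∀ x ∈ S, d x ≤ C₂ * w x ^ β
  tendsto_w : Tendsto w l (𝓝 0)
  tendsto_y : Tendsto y l (𝓝 0)

namespace PowerTail

variable {p β γ κ δ M C₁ C₂ : ℝ} {S : Set ℝ} {l : Filter ℝ} {w w' y G m d : ℝ → ℝ}

theorem rpow_eq (h : PowerTail p β γ κ δ M C₁ C₂ S l w w' y G m d) {x : ℝ} (hx : x ∈ S) :
    w x ^ κ = w x ^ β * (w x ^ δ) ^ (p - 1) := by
  rw [← Real.rpow_mul (h.w_pos x hx).le, ← Real.rpow_add (h.w_pos x hx), ← h.κ_eq]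

/-- Since `y = d w'^(p-1)` and `κ = β + δ(p-1)`, a bound of `y` by `w^κ` is a bound of `w'` by `w^δ`
after cancelling `w^β`. -/
theorem le_w' (h : PowerTail p β γ κ δ M C₁ C₂ S l w w' y G m d) {x R C : ℝ} (hx : x ∈ S)
    (hR : 0 ≤ R) (hC : 0 < C) (hd : d x ≤ C * w x ^ β) (hy : C * R ^ (p - 1) * w x ^ κ ≤ y x) :
    R * w x ^ δ ≤ w' x := by
  have hw := h.w_pos x hx
  have hw' := h.w'_pos x hx
  have hp := h.one_lt
  rw [h.rpow_eq hx, h.y_eq x hx] at hy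
  have h1 : d x * w' x ^ (p - 1) ≤ C * w x ^ β * w' x ^ (p - 1) := by gcongr
  rw [← Real.rpow_le_rpow_iff (z := p - 1) (by positivity) hw'.le (by linarith),
    Real.mul_rpow hR (by positivity)]
  refine le_of_mul_le_mul_left (a := C * w x ^ β) ?_ (by positivity)
  linarith

theorem w'_le (h : PowerTail p β γ κ δ M C₁ C₂ S l w w' y G m d) {x R C : ℝ} (hx : x ∈ S)
    (hR : 0 ≤ R) (hC : 0 < C) (hd : C * w x ^ β ≤ d x) (hy : y x ≤ C * R ^ (p - 1) * w x ^ κ) :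
    w' x ≤ R * w x ^ δ := by
  have hw := h.w_pos x hx
  have hw' := h.w'_pos x hx
  have hp := h.one_lt
  rw [h.rpow_eq hx, h.y_eq x hx] at hy
  have h1 : C * w x ^ β * w' x ^ (p - 1) ≤ d x * w' x ^ (p - 1) := by gcongr
  rw [← Real.rpow_le_rpow_iff (z := p - 1) hw'.le (by positivity) (by linarith),
    Real.mul_rpow hR (by positivity)]
  refine le_of_mul_le_mul_left (a := C * w x ^ β) ?_ (by positivity)
  linarith

theorem one_le_rpow (h : PowerTail p β γ κ δ M C₁ C₂ S l w w' y G m d) {x : ℝ} (hx : x ∈ S) :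
    1 ≤ w x ^ (κ - 1) :=
  Real.one_le_rpow_of_pos_of_le_one_of_nonpos (h.w_pos x hx) (h.w_le_one x hx)
    (by linarith [h.κ_le_one])

theorem rpow_γ_eq (h : PowerTail p β γ κ δ M C₁ C₂ S l w w' y G m d) {x : ℝ} (hx : x ∈ S) :
    w x ^ γ = w x ^ (κ - 1) * w x ^ δ := by
  rw [← Real.rpow_add (h.w_pos x hx), ← h.γ_eq]

theorem hasDerivAt_sub (h : PowerTail p β γ κ δ M C₁ C₂ S l w w' y G m d) (K : ℝ) {x : ℝ}
    (hx : x ∈ S) : HasDerivAt (fun t => y t - K * w t ^ κ)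
      (G x - m x * w' x - K * (w' x * κ * w x ^ (κ - 1))) x :=
  (h.hasDerivAt_y x hx).sub
    (((h.hasDerivAt_w x hx).rpow_const (Or.inl (h.w_pos x hx).ne')).const_mul K)

theorem tendsto_sub (h : PowerTail p β γ κ δ M C₁ C₂ S l w w' y G m d) (K : ℝ) :
    Tendsto (fun t => y t - K * w t ^ κ) l (𝓝 0) := by
  have h1 := (h.tendsto_w.rpow_const (Or.inr h.pos_κ.le)).const_mul K
  simpa [Real.zero_rpow h.pos_κ.ne'] using h.tendsto_y.sub h1

theorem exists_w'_le [l.NeBot] (h : PowerTail p β γ κ δ M C₁ C₂ S l w w' y G m d) :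
    ∃ K, ∀ x ∈ S, w' x ≤ K * w x ^ δ := by
  have hp := h.one_lt
  have hC₁ := h.pos_C₁
  have hC₂ := h.pos_C₂
  have hκ := h.pos_κ
  -- Above the barrier `C₂ R^(p-1) w^κ`, `y' ≤ (C₂ + M) w^(κ-1) w'`; the choice of `R` makes this
  -- smaller than the derivative of the barrier.
  obtain ⟨R, hR1, hR⟩ : ∃ R : ℝ, 1 ≤ R ∧ C₂ + M < C₂ * κ * R ^ (p - 1) :=
    ((eventually_ge_atTop 1).and (((tendsto_rpow_atTop (by linarith : 0 < p - 1)).const_mul_atTop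
      (by positivity : 0 < C₂ * κ)).eventually_gt_atTop (C₂ + M))).exists
  have hR0 : 0 < R := by linarith
  have hle : ∀ x ∈ S, y x - C₂ * R ^ (p - 1) * w x ^ κ ≤ 0 := by
    refine nonpos_of_deriv_neg_of_tendsto h.ordConnected h.eventually_mem
      (fun x hx => h.hasDerivAt_sub (C₂ * R ^ (p - 1)) hx) (fun x hx hE => ?_) (h.tendsto_sub _)
    have h1 := h.le_w' hx hR0.le hC₂ (h.d_le x hx) (by linarith)
    have hw' := h.w'_pos x hx
    have h2 := h.one_le_rpow hx
    have hwδ : 0 ≤ w x ^ δ := Real.rpow_nonneg (h.w_pos x hx).le _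
    have h3 : G x ≤ C₂ * (w x ^ (κ - 1) * w' x) := by
      have h4 : w x ^ δ ≤ w' x := le_trans (by nlinarith) h1
      calc G x ≤ C₂ * w x ^ γ := h.G_le x hx
        _ = C₂ * (w x ^ (κ - 1) * w x ^ δ) := by rw [h.rpow_γ_eq hx]
        _ ≤ _ := by gcongr
    have h5 : -(m x * w' x) ≤ M * (w x ^ (κ - 1) * w' x) := by
      have h6 : -m x ≤ M := (neg_le_abs _).trans (h.abs_m_le x hx)
      have h7 : w' x ≤ w x ^ (κ - 1) * w' x := le_mul_of_one_le_left hw'.le h2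
      calc -(m x * w' x) = -m x * w' x := by ring
        _ ≤ M * w' x := by gcongr
        _ ≤ _ := mul_le_mul_of_nonneg_left h7 h.nonneg_M
    have h8 : 0 < w x ^ (κ - 1) * w' x := by positivity
    have h9 := mul_lt_mul_of_pos_right hR h8
    linarith
  -- The factor turns the constant `C₂` of the barrier into the constant `C₁` of the lower bound on
  -- `d`.
  refine ⟨(C₂ / C₁) ^ (p - 1)⁻¹ * R, fun x hx =>
    h.w'_le hx (by positivity) hC₁ (h.le_d x hx) ?_⟩
  have hroot : ((C₂ / C₁) ^ (p - 1)⁻¹) ^ (p - 1) = C₂ / C₁ :=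
    Real.rpow_inv_rpow (by positivity) (by linarith)
  rw [Real.mul_rpow (by positivity) hR0.le, hroot, ← mul_assoc, mul_div_cancel₀ _ hC₁.ne']
  linarith [hle x hx]

theorem exists_le_w' [l.NeBot] (h : PowerTail p β γ κ δ M C₁ C₂ S l w w' y G m d) :
    ∃ k, 0 < k ∧ ∀ x ∈ S, k * w x ^ δ ≤ w' x := by
  have hp := h.one_lt
  have hC₁ := h.pos_C₁
  have hC₂ := h.pos_C₂
  have hκ := h.pos_κ
  -- Below the barrier `C₁ r^(p-1) w^κ` one has `w' ≤ r w^δ`, so the reaction is at least `(C₁ / r)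
  -- w^(κ-1) w'` and outweighs both convection and the growth of the barrier.
  obtain ⟨r, hr0, hr1, hr⟩ : ∃ r : ℝ, 0 < r ∧ r < 1 ∧ C₁ * κ + M < C₁ / r := by
    have h1 : Tendsto (fun r : ℝ => C₁ * r⁻¹) (𝓝[>] 0) atTop :=
      tendsto_inv_nhdsGT_zero.const_mul_atTop hC₁
    obtain ⟨r, hr, hr'⟩ := ((h1.eventually_gt_atTop (C₁ * κ + M)).and
      (Ioo_mem_nhdsGT (zero_lt_one' ℝ))).exists
    exact ⟨r, hr'.1, hr'.2, by rwa [div_eq_mul_inv]⟩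
  have hle : ∀ x ∈ S, -(y x - C₁ * r ^ (p - 1) * w x ^ κ) ≤ 0 := by
    refine nonpos_of_deriv_neg_of_tendsto h.ordConnected h.eventually_mem
      (fun x hx => (h.hasDerivAt_sub (C₁ * r ^ (p - 1)) hx).neg) (fun x hx hE => ?_)
      (by simpa using (h.tendsto_sub (C₁ * r ^ (p - 1))).neg)
    have h1 := h.w'_le hx hr0.le hC₁ (h.le_d x hx) (by linarith)
    have hw' := h.w'_pos x hx
    have h2 := h.one_le_rpow hx
    have h3 : C₁ / r * (w x ^ (κ - 1) * w' x) ≤ G x := by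
      calc C₁ / r * (w x ^ (κ - 1) * w' x) ≤ C₁ / r * (w x ^ (κ - 1) * (r * w x ^ δ)) := by gcongr
        _ = C₁ * w x ^ γ := by rw [h.rpow_γ_eq hx]; field_simp
        _ ≤ G x := h.le_G x hx
    have h5 : m x * w' x ≤ M * (w x ^ (κ - 1) * w' x) := by
      have h6 : m x ≤ M := (le_abs_self _).trans (h.abs_m_le x hx)
      have h7 : w' x ≤ w x ^ (κ - 1) * w' x := le_mul_of_one_le_left hw'.le h2
      calc m x * w' x ≤ M * w' x := by gcongr
        _ ≤ _ := mul_le_mul_of_nonneg_left h7 h.nonneg_M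
    have h8 : 0 < w x ^ (κ - 1) * w' x := by positivity
    have h9 := mul_lt_mul_of_pos_right hr h8
    have h10 : r ^ (p - 1) ≤ 1 := Real.rpow_le_one hr0.le hr1.le (by linarith)
    have h11 : C₁ * κ * (w x ^ (κ - 1) * w' x) * r ^ (p - 1) ≤ C₁ * κ * (w x ^ (κ - 1) * w' x) :=
      mul_le_of_le_one_right (by positivity) h10
    linarith
  refine ⟨(C₁ / C₂) ^ (p - 1)⁻¹ * r, by positivity, fun x hx =>
    h.le_w' hx (by positivity) hC₂ (h.d_le x hx) ?_⟩
  have hroot : ((C₁ / C₂) ^ (p - 1)⁻¹) ^ (p - 1) = C₁ / C₂ :=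
    Real.rpow_inv_rpow (by positivity) (by linarith)
  rw [Real.mul_rpow (by positivity) hr0.le, hroot, ← mul_assoc, mul_div_cancel₀ _ hC₂.ne']
  linarith [hle x hx]

/-! ### Integration of the bounds on `w'` -/

/-- The tail cannot be unbounded to the left if `δ < 1`. -/
theorem not_Iio_subset [l.NeBot] (h : PowerTail p β γ κ δ M C₁ C₂ S l w w' y G m d) (hδ : δ < 1)
    (A : ℝ) : ¬ Iio A ⊆ S := by
  intro hA
  obtain ⟨k, hk, hw'⟩ := h.exists_le_w'
  have hd : ∀ x < A, HasDerivAt (fun t => w t ^ (1 - δ) - (1 - δ) * k * t)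
      (w' x * (1 - δ) * w x ^ (1 - δ - 1) - (1 - δ) * k * 1) x := fun x hx =>
    ((h.hasDerivAt_w x (hA hx)).rpow_const (Or.inl (h.w_pos x (hA hx)).ne')).sub
      ((hasDerivAt_id x).const_mul _)
  -- `w^(1-δ)` grows at least at the constant rate `(1-δ) k`, so it cannot stay positive arbitrarily
  -- far to the left.
  have hmono : MonotoneOn (fun t => w t ^ (1 - δ) - (1 - δ) * k * t) (Iio A) := by
    refine monotoneOn_of_deriv_nonneg (convex_Iio A)
      (fun x hx => (hd x hx).continuousAt.continuousWithinAt)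
      (fun x hx => (hd x (by simpa using hx)).differentiableAt.differentiableWithinAt)
      (fun x hx => ?_)
    have hx : x < A := by simpa using hx
    rw [(hd x hx).deriv]
    have hw := h.w_pos x (hA hx)
    have h1 : k ≤ w' x * w x ^ (1 - δ - 1) := by
      have h2 := mul_le_mul_of_nonneg_right (hw' x (hA hx))
        (Real.rpow_nonneg hw.le (1 - δ - 1))
      rwa [mul_assoc, ← Real.rpow_add hw, show δ + (1 - δ - 1) = 0 by ring, Real.rpow_zero,
        mul_one] at h2
    have h3 := mul_le_mul_of_nonneg_left h1 (by linarith : 0 ≤ 1 - δ)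
    linarith
  have hδk : 0 < (1 - δ) * k := mul_pos (by linarith) hk
  -- The distance to the left of `A - 1` within which that rate exhausts `w^(1-δ)`.
  set q := w (A - 1) ^ (1 - δ) / ((1 - δ) * k) with hq
  have hqe : q * ((1 - δ) * k) = w (A - 1) ^ (1 - δ) := div_mul_cancel₀ _ hδk.ne'
  have hq0 : 0 ≤ q := div_nonneg
    (Real.rpow_nonneg (h.w_pos _ (hA (by simp : A - 1 ∈ Iio A))).le _) hδk.le
  have hx : A - 1 - q ∈ Iio A := by simp only [mem_Iio]; linarith
  have h1 := hmono hx (by simp : A - 1 ∈ Iio A) (by linarith)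
  have h2 := Real.rpow_pos_of_pos (h.w_pos _ (hA hx)) (1 - δ)
  simp only at h1
  nlinarith

/-- The tail can start at a finite point only if `δ < 1`. -/
theorem δ_lt_one_of_Ioo {a b : ℝ} (hab : a < b)
    (h : PowerTail p β γ κ δ M C₁ C₂ (Ioo a b) (𝓝[>] a) w w' y G m d) : δ < 1 := by
  by_contra! hδ
  obtain ⟨K, hw'⟩ := h.exists_w'_le
  have hd : ∀ x ∈ Ioo a b, HasDerivAt (fun t => Real.log (w t) - K * t)
      (w' x / w x - K * 1) x := fun x hx =>
    ((h.hasDerivAt_w x hx).log (h.w_pos x hx).ne').sub ((hasDerivAt_id x).const_mul _)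
  -- With `δ ≥ 1` and `w ≤ 1`, `w' ≤ K w`; so `log w` stays bounded below near `a`, although `w → 0`
  -- there.
  have hanti : AntitoneOn (fun t => Real.log (w t) - K * t) (Ioo a b) := by
    refine antitoneOn_of_deriv_nonpos (convex_Ioo a b)
      (fun x hx => (hd x hx).continuousAt.continuousWithinAt)
      (fun x hx => (hd x (by simpa using hx)).differentiableAt.differentiableWithinAt)
      (fun x hx => ?_)
    have hx : x ∈ Ioo a b := by simpa using hx
    rw [(hd x hx).deriv]
    have hw := h.w_pos x hx
    have hK : 0 ≤ K := by
      have := (h.w'_pos x hx).trans_le (hw' x hx)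
      exact (pos_of_mul_pos_left this (Real.rpow_nonneg hw.le _)).le
    have h1 : w x ^ δ ≤ w x := by
      simpa using Real.rpow_le_rpow_of_exponent_ge hw (h.w_le_one x hx) hδ
    have h2 : w' x / w x ≤ K := by
      rw [div_le_iff₀ hw]
      exact (hw' x hx).trans (mul_le_mul_of_nonneg_left h1 hK)
    linarith
  have hw0 : Tendsto w (𝓝[>] a) (𝓝[>] 0) := by
    refine tendsto_nhdsWithin_iff.2 ⟨h.tendsto_w, ?_⟩
    filter_upwards [Ioo_mem_nhdsGT hab] with x hx using h.w_pos x hx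
  have hlog := Real.tendsto_log_nhdsGT_zero.comp hw0
  have hid : Tendsto (fun t : ℝ => K * t) (𝓝[>] a) (𝓝 (K * a)) :=
    (tendsto_id.const_mul K).mono_left nhdsWithin_le_nhds
  have hbot : Tendsto (fun t => Real.log (w t) - K * t) (𝓝[>] a) atBot := by
    simpa [sub_eq_add_neg, Function.comp_def] using hlog.atBot_add hid.neg
  have hc : (a + b) / 2 ∈ Ioo a b := ⟨by linarith, by linarith⟩
  obtain ⟨t, ht, ht'⟩ := ((hbot.eventually_lt_atBot
    (Real.log (w ((a + b) / 2)) - K * ((a + b) / 2))).and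
      (Ioo_mem_nhdsGT (show a < (a + b) / 2 by linarith))).exists
  have := hanti ⟨ht'.1, ht'.2.trans hc.2⟩ hc ht'.2.le
  simp only at this
  linarith

end PowerTail

theorem SimilarAlong.exists_bounds {l : Filter ℝ} {f₁ f₂ : ℝ → ℝ} (h : SimilarAlong l f₁ f₂)
    (hpos : ∀ᶠ s in l, 0 < f₂ s) :
    ∃ C₁ C₂, 0 < C₁ ∧ 0 < C₂ ∧ ∀ᶠ s in l, C₁ * f₂ s ≤ f₁ s ∧ f₁ s ≤ C₂ * f₂ s := by
  obtain ⟨L, hL, hlim⟩ := h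
  refine ⟨L / 2, 2 * L, by linarith, by linarith, ?_⟩
  filter_upwards [hpos, hlim.eventually (lt_mem_nhds (show L / 2 < L by linarith)),
    hlim.eventually (gt_mem_nhds (show L < 2 * L by linarith))] with s hs h1 h2
  exact ⟨((lt_div_iff₀ hs).1 h1).le, ((div_lt_iff₀ hs).1 h2).le⟩

/-! ### Profiles near the equilibrium `1` -/

namespace IsWaveProfile

variable {p c θ : ℝ} {D H g u : ℝ → ℝ}

theorem isOpen_transitionSet (hu : IsWaveProfile p c D H g u) : IsOpen (transitionSet u) :=
  (isOpen_lt continuous_const hu.continuous).inter (isOpen_lt hu.continuous continuous_const)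

theorem differentiableAt (hu : IsWaveProfile p c D H g u) {ξ : ℝ} (hξ : ξ ∈ transitionSet u) :
    DifferentiableAt ℝ u ξ :=
  (hu.contDiffOn.differentiableOn one_ne_zero).differentiableAt
    (hu.isOpen_transitionSet.mem_nhds hξ)

/-- A profile that does not decrease at a point above the ignition value takes smaller values
immediately to the left. -/
theorem eventually_lt_of_deriv_nonneg (hDpos : ∀ v ∈ Ioo (0 : ℝ) 1, 0 < D v)
    (hgpos : ∀ v ∈ Ioo θ 1, 0 < g v) (hu : IsWaveProfile p c D H g u) {ξ : ℝ}
    (hξ : ξ ∈ transitionSet u) (hθ : θ < u ξ) (hd : 0 ≤ deriv u ξ) :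
    ∀ᶠ x in 𝓝[<] ξ, u x < u ξ := by
  have left : ∀ {f : ℝ → ℝ} {f' : ℝ}, HasDerivAt f f' ξ → 0 < f' → ∀ᶠ x in 𝓝[<] ξ, f x < f ξ := by
    intro f f' hf hf'
    filter_upwards [((hasDerivAt_iff_tendsto_slope_left_right.1 hf).1).eventually
      (lt_mem_nhds hf'), self_mem_nhdsWithin] with x hx (hxξ : x < ξ)
    rw [slope_def_field, div_pos_iff] at hx
    rcases hx with hx | hx <;> linarith [hx.1, hx.2]
  rcases hd.lt_or_eq with hd | hd
  · exact left (hu.differentiableAt hξ).hasDerivAt hd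
  have hF0 : waveFlux p D u ξ = 0 := by simp [waveFlux, ← hd]
  have hF := hu.equation ξ hξ
  rw [← hd] at hF
  -- At a critical point the flux vanishes with derivative `-g < 0`, so it is positive just to the
  -- left, and `u' > 0` there.
  have hF' : deriv (waveFlux p D u) ξ < 0 := by linarith [hgpos _ ⟨hθ, hξ.2⟩]
  have h1 := left (hu.flux_differentiableAt ξ hξ).hasDerivAt.neg (by linarith)
  have h2 : ∀ᶠ x in 𝓝[<] ξ, x ∈ transitionSet u :=
    nhdsWithin_le_nhds (hu.isOpen_transitionSet.mem_nhds hξ)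
  obtain ⟨a, ha, hsub⟩ := mem_nhdsLT_iff_exists_Ioo_subset.1 (h1.and h2)
  have ha : a < ξ := ha
  have hderiv : ∀ x ∈ Ioo a ξ, 0 < deriv u x := by
    intro x hx
    obtain ⟨hx1, hx2⟩ := hsub hx
    simp only [Pi.neg_apply, hF0] at hx1
    have hx3 : 0 < waveFlux p D u x := by linarith
    have hDx := hDpos _ hx2
    by_contra! hle
    have : waveFlux p D u x ≤ 0 :=
      mul_nonpos_of_nonneg_of_nonpos (by positivity) hle
    linarith
  have hmono : StrictMonoOn u (Ioc a ξ) := by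
    refine strictMonoOn_of_deriv_pos (convex_Ioc a ξ) hu.continuous.continuousOn fun x hx => ?_
    rw [interior_Ioc] at hx
    exact hderiv x hx
  filter_upwards [Ioo_mem_nhdsLT ha] with x hx
  exact hmono ⟨hx.1, hx.2.le⟩ ⟨ha, le_rfl⟩ hx.2

/-- Otherwise `u` dips below `u ξ ≤ u a` inside `(a, ξ)` and has an interior minimum there, yet a
critical point above `θ` has smaller values to its left. -/
theorem deriv_neg (hDpos : ∀ v ∈ Ioo (0 : ℝ) 1, 0 < D v) (hgpos : ∀ v ∈ Ioo θ 1, 0 < g v)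
    (hθ : 0 ≤ θ) (hu : IsWaveProfile p c D H g u) {a ξ : ℝ} (haξ : a < ξ)
    (hgt : ∀ x ∈ Icc a ξ, θ < u x) (hξ : u ξ < 1) (hle : u ξ ≤ u a) : deriv u ξ < 0 := by
  by_contra! hd
  have hmem : ∀ x ∈ Icc a ξ, u x < 1 → x ∈ transitionSet u := fun x hx hx1 =>
    ⟨hθ.trans_lt (hgt x hx), hx1⟩
  have hξI : ξ ∈ Icc a ξ := right_mem_Icc.2 haξ.le
  obtain ⟨x, hx, hxI⟩ := ((hu.eventually_lt_of_deriv_nonneg hDpos hgpos (hmem ξ hξI hξ)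
    (hgt ξ hξI) hd).and (Ioo_mem_nhdsLT haξ)).exists
  obtain ⟨m, hm, hmin⟩ := isCompact_Icc.exists_isMinOn (nonempty_Icc.2 haξ.le)
    (hu.continuous.continuousOn (s := Icc a ξ))
  have hmx : u m ≤ u x := hmin (Ioo_subset_Icc_self hxI)
  have ham : a < m := lt_of_le_of_ne hm.1 (by rintro rfl; linarith)
  have hmξ : m < ξ := lt_of_le_of_ne hm.2 (by rintro rfl; linarith)
  have hd0 := (hmin.isLocalMin (Icc_mem_nhds ham hmξ)).deriv_eq_zero
  obtain ⟨s, hs, hsI⟩ := ((hu.eventually_lt_of_deriv_nonneg hDpos hgpos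
    (hmem m hm (by linarith)) (hgt m hm) hd0.ge).and (Ioo_mem_nhdsLT ham)).exists
  have : u m ≤ u s := hmin ⟨hsI.1.le, hsI.2.le.trans hm.2⟩
  linarith

theorem exists_abs_convVelocity_le (c : ℝ) (hH : ContDiffOn ℝ 1 H (Icc 0 1)) :
    ∃ M, 0 ≤ M ∧ ∀ v ∈ Icc (0 : ℝ) 1, |c + convVelocity H v| ≤ M := by
  have hcont : ContinuousOn (fun v => c + convVelocity H v) (Icc 0 1) :=
    continuousOn_const.add
      (hH.continuousOn_derivWithin (uniqueDiffOn_Icc zero_lt_one) le_rfl)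
  obtain ⟨M, hM⟩ := isCompact_Icc.exists_bound_of_continuousOn hcont
  exact ⟨M, (norm_nonneg _).trans (hM 0 (by simp)), hM⟩

/-- Near the equilibrium `1`, a decreasing piece of a profile is a power tail. -/
theorem exists_powerTail {β γ : ℝ} (hp : 1 < p) (hθ : θ ∈ Ioo (0 : ℝ) 1)
    (hDpos : ∀ v ∈ Ioo (0 : ℝ) 1, 0 < D v)
    (hH : ContDiffOn ℝ 1 H (Icc 0 1)) (hgpos : ∀ v ∈ Ioo θ 1, 0 < g v)
    (hu : IsWaveProfile p c D H g u)
    (hDβ : SimilarAlong (𝓝[<] 1) D (fun v => (1 - v) ^ β))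
    (hgγ : SimilarAlong (𝓝[<] 1) g (fun v => (1 - v) ^ γ))
    (hlow : -1 < γ + β / (p - 1)) (hupp : γ + β / (p - 1) ≤ 1 / (p - 1)) :
    ∃ r ∈ Ico θ 1, ∃ κ M C₁ C₂, ∀ (S : Set ℝ) (l : Filter ℝ), S.OrdConnected →
      (∀ x ∈ S, ∀ᶠ t in l, t ∈ S ∧ t ≤ x) → (∀ x ∈ S, u x ∈ Ioo r 1) → Tendsto u l (𝓝 1) →
      (∀ x ∈ S, ∃ a < x, (∀ t ∈ Icc a x, θ < u t) ∧ u x ≤ u a) →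
      PowerTail p β γ κ ((γ - β + 1) / p) M C₁ C₂ S l (fun x => 1 - u x) (fun x => -deriv u x)
        (fun x => -waveFlux p D u x) (fun x => g (u x)) (fun x => c + convVelocity H (u x))
        (fun x => D (u x)) := by
  obtain ⟨M, hM0, hM⟩ := exists_abs_convVelocity_le c hH
  have hpow : ∀ s : ℝ, ∀ᶠ v in 𝓝[<] (1 : ℝ), 0 < (1 - v) ^ s := fun s => by
    filter_upwards [self_mem_nhdsWithin] with v (hv : v < 1)
    exact Real.rpow_pos_of_pos (by linarith) _
  obtain ⟨A₁, A₂, hA₁, hA₂, hA⟩ := hDβ.exists_bounds (hpow β)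
  obtain ⟨B₁, B₂, hB₁, hB₂, hB⟩ := hgγ.exists_bounds (hpow γ)
  obtain ⟨r, hr, hsub⟩ := (mem_nhdsLT_iff_exists_mem_Ico_Ioo_subset hθ.2).1 (hA.and hB)
  have hp1 : 0 < p - 1 := by linarith
  have hp0 : 0 < p := by linarith
  have e1 : γ * (p - 1) + β ≤ 1 := by
    have := mul_le_mul_of_nonneg_right hupp hp1.le
    rwa [add_mul, div_mul_cancel₀ _ hp1.ne', div_mul_cancel₀ _ hp1.ne'] at this
  have e2 : -(p - 1) < γ * (p - 1) + β := by
    have := mul_lt_mul_of_pos_right hlow hp1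
    rw [add_mul, div_mul_cancel₀ _ hp1.ne'] at this
    linarith
  -- This is `β + δ(p-1)` over the common denominator; `e2` and `e1` give `0 < κ` and `κ ≤ 1`.
  refine ⟨r, hr, (γ * (p - 1) + β + (p - 1)) / p, M, min A₁ B₁, max A₂ B₂, ?_⟩
  intro S l hS hl hrS hlim hdec
  have h0r : 0 < r := hθ.1.trans_le hr.1
  have hI : ∀ x ∈ S, x ∈ transitionSet u := fun x hx =>
    ⟨h0r.trans (hrS x hx).1, (hrS x hx).2⟩
  have hdneg : ∀ x ∈ S, deriv u x < 0 := fun x hx => by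
    obtain ⟨a, ha, h1, h2⟩ := hdec x hx
    exact hu.deriv_neg hDpos hgpos hθ.1.le ha h1 (hI x hx).2 h2
  have hw : ∀ x ∈ S, 0 < 1 - u x := fun x hx => by linarith [(hI x hx).2]
  exact
    { one_lt := hp
      pos_C₁ := lt_min hA₁ hB₁
      pos_C₂ := lt_max_of_lt_left hA₂
      nonneg_M := hM0
      pos_κ := div_pos (by linarith) hp0
      κ_le_one := (div_le_one hp0).2 (by linarith)
      γ_eq := by field_simp; ring
      κ_eq := by field_simp; ring
      ordConnected := hS
      eventually_mem := hl
      w_pos := hw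
      w_le_one := fun x hx => by linarith [(hI x hx).1]
      w'_pos := fun x hx => by linarith [hdneg x hx]
      hasDerivAt_w := fun x hx => (hu.differentiableAt (hI x hx)).hasDerivAt.const_sub 1
      hasDerivAt_y := fun x hx => by
        refine (hu.flux_differentiableAt x (hI x hx)).hasDerivAt.neg.congr_deriv ?_
        linarith [hu.equation x (hI x hx)]
      abs_m_le := fun x hx => hM _ (hu.mem_Icc x)
      y_eq := fun x hx => by
        have h1 := hdneg x hx
        have h2 : (-deriv u x) ^ (p - 1) = (-deriv u x) ^ (p - 2) * (-deriv u x) := by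
          rw [← Real.rpow_add_one (by linarith)]; congr 1; ring
        rw [h2, waveFlux, abs_of_neg h1]
        ring
      le_G := fun x hx => le_trans (mul_le_mul_of_nonneg_right (min_le_right _ _)
        (Real.rpow_nonneg (hw x hx).le _)) (hsub (hrS x hx)).2.1
      G_le := fun x hx => (hsub (hrS x hx)).2.2.trans (mul_le_mul_of_nonneg_right
        (le_max_right _ _) (Real.rpow_nonneg (hw x hx).le _))
      le_d := fun x hx => le_trans (mul_le_mul_of_nonneg_right (min_le_left _ _)
        (Real.rpow_nonneg (hw x hx).le _)) (hsub (hrS x hx)).1.1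
      d_le := fun x hx => (hsub (hrS x hx)).1.2.trans (mul_le_mul_of_nonneg_right
        (le_max_left _ _) (Real.rpow_nonneg (hw x hx).le _))
      tendsto_w := by simpa using hlim.const_sub 1
      tendsto_y := by
        simpa using (hu.flux_one.comp (tendsto_comap_iff.2 hlim)).neg }

theorem exists_le_forall_lt (hu : IsWaveProfile p c D H g u) {r : ℝ} (hr : r < 1) :
    ∃ A, ∀ x ≤ A, r < u x :=
  eventually_atBot.1 (hu.tendsto_atBot.eventually (lt_mem_nhds hr))

theorem exists_lt_le (hu : IsWaveProfile p c D H g u) {x : ℝ} (hx : u x < 1) :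
    ∃ a < x, u x ≤ u a := by
  obtain ⟨a, ha, hax⟩ := ((hu.tendsto_atBot.eventually (lt_mem_nhds hx)).and
    (eventually_lt_atBot x)).exists
  exact ⟨a, hax, ha.le⟩

/-- Where the profile stays above the ignition value, it does not return to `1`. -/
theorem lt_one_of_le (hDpos : ∀ v ∈ Ioo (0 : ℝ) 1, 0 < D v) (hgpos : ∀ v ∈ Ioo θ 1, 0 < g v)
    (hθ : 0 ≤ θ) (hu : IsWaveProfile p c D H g u) {A x y : ℝ} (hA : ∀ t ≤ A, θ < u t)
    (hx : u x < 1) (hxy : x ≤ y) (hy : y ≤ A) : u y < 1 := by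
  by_contra! hy1
  have hclosed : IsClosed (Icc x y ∩ u ⁻¹' Ici 1) :=
    isClosed_Icc.inter (isClosed_Ici.preimage hu.continuous)
  have hbdd : BddBelow (Icc x y ∩ u ⁻¹' Ici 1) := ⟨x, fun t ht => ht.1.1⟩
  set s := sInf (Icc x y ∩ u ⁻¹' Ici 1) with hs
  have hsmem : s ∈ Icc x y ∩ u ⁻¹' Ici 1 := hclosed.csInf_mem ⟨y, ⟨hxy, le_rfl⟩, hy1⟩ hbdd
  have hs1 : 1 ≤ u s := hsmem.2
  have hlt : ∀ t ∈ Ico x s, u t < 1 := fun t ht => by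
    by_contra! h
    exact (csInf_le hbdd ⟨⟨ht.1, ht.2.le.trans hsmem.1.2⟩, h⟩).not_gt ht.2
  -- Up to the first return `s` to `1` the profile decreases, so it cannot rise from `u x < 1`.
  have hanti : AntitoneOn u (Icc x s) := by
    have hderiv : ∀ t ∈ Ioo x s, deriv u t < 0 := fun t ht => by
      obtain ⟨a, ha, hle⟩ := hu.exists_lt_le (hlt t ⟨ht.1.le, ht.2⟩)
      exact hu.deriv_neg hDpos hgpos hθ ha
        (fun q hq => hA q (hq.2.trans (ht.2.le.trans (hsmem.1.2.trans hy))))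
        (hlt t ⟨ht.1.le, ht.2⟩) hle
    refine antitoneOn_of_deriv_nonpos (convex_Icc x s) hu.continuous.continuousOn
      (fun t ht => ?_) (fun t ht => ?_) <;> rw [interior_Icc] at ht
    · exact (differentiableAt_of_deriv_ne_zero (hderiv t ht).ne).differentiableWithinAt
    · exact (hderiv t ht).le
  have := hanti (left_mem_Icc.2 hsmem.1.1) (right_mem_Icc.2 hsmem.1.1) hsmem.1.1
  linarith

theorem transitionSet_nonempty (hu : IsWaveProfile p c D H g u) : (transitionSet u).Nonempty := by
  obtain ⟨a, ha⟩ := (hu.tendsto_atBot.eventually (lt_mem_nhds (show (1 / 2 : ℝ) < 1 by norm_num))).exists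
  obtain ⟨b, hb⟩ := (hu.tendsto_atTop.eventually (gt_mem_nhds (show (0 : ℝ) < 1 / 2 by norm_num))).exists
  obtain ⟨x, hx⟩ := mem_range_of_exists_le_of_exists_ge hu.continuous ⟨b, hb.le⟩ ⟨a, ha.le⟩
  exact ⟨x, by rw [hx]; norm_num, by rw [hx]; norm_num⟩

theorem eq_one_of_bddBelow (hu : IsWaveProfile p c D H g u) (hbdd : BddBelow (transitionSet u)) :
    ∃ a : ℝ, leftEndpoint u = (a : EReal) ∧ ∀ ξ ≤ a, u ξ = 1 := by
  have hne := hu.transitionSet_nonempty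
  set a := sInf (transitionSet u) with ha
  refine ⟨a, ?_, ?_⟩
  · refine IsGLB.sInf_eq ⟨?_, fun b hb => ?_⟩
    · rintro _ ⟨x, hx, rfl⟩
      exact EReal.coe_le_coe_iff.2 (csInf_le hbdd hx)
    · induction b with
      | bot => exact bot_le
      | coe b =>
        exact EReal.coe_le_coe_iff.2 (le_csInf hne fun x hx =>
          EReal.coe_le_coe_iff.1 (hb ⟨x, hx, rfl⟩))
      | top =>
        obtain ⟨x, hx⟩ := hne
        exact absurd (hb ⟨x, hx, rfl⟩) (by simp)
  · have hlt : ∀ ξ < a, u ξ = 1 := by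
      intro ξ hξ
      by_contra hne1
      have h1 : u ξ < 1 := lt_of_le_of_ne (hu.mem_Icc ξ).2 hne1
      -- The level is `max (u ξ) (1 / 2)` because `u ξ` may be `0`, and the level must lie in `(0,
      -- 1)`.
      obtain ⟨t, ht, htξ⟩ := ((hu.tendsto_atBot.eventually
        (lt_mem_nhds (show (max (u ξ) (1 / 2)) < 1 by simp [h1]; norm_num))).and
          (eventually_le_atBot ξ)).exists
      obtain ⟨q, hq, hqu⟩ := intermediate_value_Icc' htξ hu.continuous.continuousOn
        (show max (u ξ) (1 / 2) ∈ Icc (u ξ) (u t) from ⟨le_max_left _ _, ht.le⟩)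
      have hmem : q ∈ transitionSet u := by
        refine ⟨?_, ?_⟩ <;> rw [hqu]
        · exact lt_max_of_lt_right (by norm_num)
        · simp [h1]; norm_num
      exact (csInf_le hbdd hmem).not_gt (hq.2.trans_lt hξ)
    have hsub : Iic a ⊆ u ⁻¹' {1} := by
      rw [← closure_Iio]
      exact closure_minimal hlt (isClosed_singleton.preimage hu.continuous)
    exact hsub

theorem leftEndpoint_eq_bot (hu : IsWaveProfile p c D H g u) (hlt : ∀ ξ, u ξ < 1) :
    leftEndpoint u = ⊥ := by
  refine (sInf_eq_bot).2 fun b hb => ?_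
  obtain ⟨x, hx⟩ : ∃ x : ℝ, (x : EReal) < b := by
    obtain ⟨q, -, hq⟩ := EReal.lt_iff_exists_real_btwn.1 hb
    exact ⟨q, hq⟩
  obtain ⟨t, ht, htx⟩ := ((hu.tendsto_atBot.eventually (lt_mem_nhds zero_lt_one)).and
    (eventually_le_atBot x)).exists
  exact ⟨_, ⟨t, ⟨ht, hlt t⟩, rfl⟩, (EReal.coe_le_coe_iff.2 htx).trans_lt hx⟩

end IsWaveProfile

/-! ### The dichotomy at `δ = 1` -/

theorem theorem4
    (p θ c β γ : ℝ) (D H g u : ℝ → ℝ)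
    (hp : 1 < p)
    (hθ : θ ∈ Ioo (0 : ℝ) 1)
    -- diffusion coefficient
    (hD : ContDiffOn ℝ 1 D (Ioo 0 1))
    (hDpos : ∀ v ∈ Ioo (0 : ℝ) 1, 0 < D v)
    -- convective flux
    (hH : ContDiffOn ℝ 1 H (Icc 0 1))
    (hHzero : H 0 = 0)
    (hHpos : ∀ v ∈ Ioc (0 : ℝ) 1, 0 < H v)
    -- combustion-type reaction
    (hg : ContinuousOn g (Icc 0 1))
    (hgzero : ∀ v ∈ Icc (0 : ℝ) θ, g v = 0)
    (hgpos : ∀ v ∈ Ioo θ 1, 0 < g v)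
    (hgone : g 1 = 0)
    -- travelling wave profile with positive speed
    (hc : 0 < c)
    (hu : IsWaveProfile p c D H g u)
    -- power-type behaviour near the equilibrium 1
    (hγ : 0 < γ)
    (hDβ : SimilarAlong (𝓝[<] 1) D (fun v => (1 - v) ^ β))
    (hgγ : SimilarAlong (𝓝[<] 1) g (fun v => (1 - v) ^ γ))
    (hlow : -1 < γ + β / (p - 1))
    (hupp : γ + β / (p - 1) ≤ 1 / (p - 1)) :
    ((γ - β + 1) / p < 1 →
      ∃ a : ℝ, leftEndpoint u = (a : EReal) ∧ ∀ ξ ≤ a, u ξ = 1) ∧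
    (1 ≤ (γ - β + 1) / p →
      leftEndpoint u = ⊥ ∧ ∀ ξ, u ξ < 1) := by

  obtain ⟨r, hr, κ, M, C₁, C₂, htail⟩ :=
    hu.exists_powerTail hp hθ hDpos hH hgpos hDβ hgγ hlow hupp
  refine ⟨fun hδ => hu.eq_one_of_bddBelow ?_, fun hδ => ?_⟩
  · by_contra hbdd
    obtain ⟨A, hA⟩ := hu.exists_le_forall_lt hr.2
    have hAθ : ∀ x ≤ A, θ < u x := fun x hx => hr.1.trans_lt (hA x hx)
    have hlt : ∀ x ≤ A, u x < 1 := fun x hx => by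
      obtain ⟨t, ht, htx⟩ := not_bddBelow_iff.1 hbdd x
      exact hu.lt_one_of_le hDpos hgpos hθ.1.le hAθ ht.2 htx.le hx
    refine (htail (Iio A) atBot ordConnected_Iio (fun x hx => ?_)
      (fun x (hx : x < A) => ⟨hA x hx.le, hlt x hx.le⟩) hu.tendsto_atBot
      (fun x (hx : x < A) => ?_)).not_Iio_subset hδ A subset_rfl
    · filter_upwards [eventually_lt_atBot A, eventually_le_atBot x] with t h1 h2 using ⟨h1, h2⟩
    · obtain ⟨a, ha, hle⟩ := hu.exists_lt_le (hlt x hx.le)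
      exact ⟨a, ha, fun t ht => hAθ t (ht.2.trans hx.le), hle⟩
  · suffices hlt : ∀ ξ, u ξ < 1 from ⟨hu.leftEndpoint_eq_bot hlt, hlt⟩
    by_contra! hex
    have hclosed : IsClosed (u ⁻¹' Ici 1) := isClosed_Ici.preimage hu.continuous
    have hbdd : BddAbove (u ⁻¹' Ici 1) := by
      obtain ⟨B, hB⟩ := eventually_atTop.1 (hu.tendsto_atTop.eventually (gt_mem_nhds zero_lt_one))
      exact ⟨B, fun x hx => le_of_not_ge fun h => (hB x h).not_ge hx⟩
    -- To the right of the last point where `u = 1`, a tail starts at a finite point, which forces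
    -- `δ < 1`.
    set a := sSup (u ⁻¹' Ici 1) with ha
    have ha1 : u a = 1 := le_antisymm (hu.mem_Icc a).2 (hclosed.csSup_mem hex hbdd)
    have hlt : ∀ x, a < x → u x < 1 := fun x hx => by
      by_contra! h
      exact (le_csSup hbdd h).not_gt hx
    have hnear : ∀ᶠ x in 𝓝[≥] a, r < u x := nhdsWithin_le_nhds
      (hu.continuous.continuousAt.eventually (lt_mem_nhds (by rw [ha1]; exact hr.2)))
    obtain ⟨b, hab, hb⟩ := mem_nhdsGE_iff_exists_Ico_subset.1 hnear
    have hab : a < b := hab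
    refine hδ.not_gt ((htail (Ioo a b) (𝓝[>] a) ordConnected_Ioo (fun x hx => ?_)
      (fun x hx => ⟨hb ⟨hx.1.le, hx.2⟩, hlt x hx.1⟩) ?_ (fun x hx => ?_)).δ_lt_one_of_Ioo hab)
    · filter_upwards [Ioo_mem_nhdsGT hx.1] with t ht
      exact ⟨⟨ht.1, ht.2.trans hx.2⟩, ht.2.le⟩
    · exact ha1 ▸ hu.continuous.continuousAt.tendsto.mono_left nhdsWithin_le_nhds
    · exact ⟨a, hx.1, fun t ht => hr.1.trans_lt (hb ⟨ht.1, ht.2.trans_lt hx.2⟩),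
        ha1 ▸ (hu.mem_Icc x).2⟩
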